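/- Let $X\neq\{0\}$ be a complex Banach space and $1\le p<\infty$. Let $\mathbb T=\{z\in\mathbb C:|z|=1\}$, and let $\mathbb T^N$ and $\mathbb T^\infty=\prod_{k\ge1}\mathbb T$ carry the product of the normalized Lebesgue measure on $\mathbb T$. For $2\le q<\infty$, $X$ has cotype $q$ if there is $C\ge 0$ such that for all $N$ and all $x_1,\dots,x_N\in X$ $$\Big(\sum_{k=1}^N\|x_k\|^q\Big)^{1/q}\le C\Big(\int_{\mathbb T^N}\Big\|\sum_{k=1}^N x_kz_k\Big\|^2dz\Big)^{1/2}.$$ Let $\cot(X)\in[2,\infty]$ be the infimum of all $2\le q<\infty$ such that $X$ has cotype $q$ ($=\infty$ if there are none). For $f\in L_1(\mathbb T^\infty,X)$ and a finitely supported integer sequence $\alpha$ put $\hat f(\alpha)=\int_{\mathbb T^\infty} f(w)w^{-\alpha}\,dw$, and let $H_p(\mathbb T^\infty,X)$ be the space of all $f\in L_p(\mathbb T^\infty,X)$ with $\hat f(\alpha)=0$ whenever $\alpha$ has a negative entry. Let $\mathcal H_p(X)$ be the set of all Dirichlet series $D=\sum_{n\ge 1} a_nn^{-s}$ in $X$ for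 which there is $f\in H_p(\mathbb T^\infty,X)$ with $a_{p_1^{\alpha_1}p_2^{\alpha_2}\cdots}=\hat f(\alpha)$ for all finitely supported sequences $\alpha$ of nonnegative integers, where $p_1<p_2<\dots$ are the primes. Let $\sigma_a(D)$ be the abscissa of absolute convergence of $D$, let $\sigma_{\mathcal H_p(X)}(D)$ be the infimum of all $\sigma\in\mathbb R$ with $\sum_n \frac{a_n}{n^\sigma}n^{-s}\in\mathcal H_p(X)$, and $$S_p(X)=\sup_{D}\big(\sigma_a(D)-\sigma_{\mathcal H_p(X)}(D)\big),$$ the supremum being over all Dirichlet series $D$ in $X$ for which this difference of extended real numbers is defined. Let $B_{c_0}$ be the open unit ball of the complex Banach space $c_0$ of null sequences, let $$\operatorname{mon}H_p(\mathbb T^\infty,X)=\Big\{z\in B_{c_0}:\ \sum_{\alpha}\|\hat f(\alpha)z^\alpha\|<\infty\ \text{ for all } f\in H_p(\mathbb T^\infty,X)\Big\},$$ where $\alpha$ runs over the finitely supported sequences of nonnegative integers, and let $M_p(X)=\sup\{1\le r\le\infty:\ \ell_r\cap B_{c_0}\subset\operatorname{mon}H_p(\mathbb T^\infty,X)\}$.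 For $1\le r\le\infty$ let $r'=r/(r-1)\in[1,\infty]$ be the conjugate exponent (with $\infty'=1$ and $1'=\infty$). Then: 1. If $1<r\le\infty$ and $\ell_r\cap B_{c_0}\subset \operatorname{mon}H_p(\mathbb T^\infty,X)$, then $2\le r'<\infty$ and $X$ has cotype $r'$. 2. $M_p(X)\le \dfrac{\cot(X)}{\cot(X)-1}$, the right-hand side being $1$ if $\cot(X)=\infty$. 3. $1-\dfrac1{\cot(X)}\le S_p(X)$, and also $1-\dfrac1{\cot(X)}\le\sup_{D\in\mathcal H_p(X)}\sigma_a(D)$, where $1/\infty=0$. -/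

import Mathlib

open scoped ENNReal Topology

noncomputable section

namespace VHardy

/-- The unit circle `𝕋 = {z ∈ ℂ : |z| = 1}` carries its Borel σ-algebra. -/
instance : MeasurableSpace Circle := borel Circle

instance : BorelSpace Circle := ⟨rfl⟩

/-- Normalized Lebesgue (= Haar) measure on the circle. -/
def circleMeasure : MeasureTheory.Measure Circle :=
  MeasureTheory.Measure.haarMeasure (⊤ : TopologicalSpace.PositiveCompacts Circle)

instance : MeasureTheory.IsProbabilityMeasure circleMeasure :=
  ⟨MeasureTheory.Measure.haarMeasure_self⟩

/-- The measure `dz` on the finite dimensional polytorus `𝕋 ^ N`. -/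
def torusMeasure (N : ℕ) : MeasureTheory.Measure (Fin N → Circle) :=
  MeasureTheory.Measure.pi fun _ => circleMeasure

/-- The measure `dw` on the infinite dimensional polytorus `𝕋 ^ ∞`: the countable product of the
normalized Lebesgue measure on `𝕋`. -/
def polytorusMeasure : MeasureTheory.Measure (ℕ → Circle) :=
  MeasureTheory.Measure.infinitePi fun _ => circleMeasure

section

variable (X : Type*) [NormedAddCommGroup X] [NormedSpace ℂ X]

/-- `X` has cotype `q`, where `2 ≤ q < ∞`. -/
def HasCotype (q : ℝ) : Prop :=
  2 ≤ q ∧ ∃ C : ℝ, 0 ≤ C ∧ ∀ (N : ℕ) (x : Fin N → X),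
    (∑ k, ‖x k‖ ^ q) ^ (1 / q) ≤
      C * (∫ z, ‖∑ k, (z k : ℂ) • x k‖ ^ 2 ∂(torusMeasure N)) ^ (1 / 2 : ℝ)

/-- The optimal cotype of `X`, an element of `[2, ∞]`; it is `∞` if `X` has no finite cotype. -/
def cot : ℝ≥0∞ :=
  ⨅ (q : ℝ) (_ : HasCotype X q), ENNReal.ofReal q

variable {X}

/-- The monomial `w ^ α` on `𝕋 ^ ∞`, for a finitely supported `α` with integer entries. -/
def torusMonomial (α : ℕ →₀ ℤ) (w : ℕ → Circle) : ℂ :=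
  α.prod fun j k => (w j : ℂ) ^ k

/-- The Fourier coefficient `∫ f(w) w ^ (-α) dw`. -/
def torusCoeff (f : (ℕ → Circle) → X) (α : ℕ →₀ ℤ) : X :=
  ∫ w, torusMonomial (-α) w • f w ∂polytorusMeasure

/-- The Fourier coefficient at a multi index with entries in the natural numbers. -/
def powerCoeff (f : (ℕ → Circle) → X) (α : ℕ →₀ ℕ) : X :=
  torusCoeff f (α.mapRange (fun k : ℕ => (k : ℤ)) Nat.cast_zero)

variable (X)

/-- The Hardy space `H_p(𝕋 ^ ∞, X)` (as a set of representatives): the functions in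
`L_p(𝕋 ^ ∞, X)` whose Fourier coefficients vanish at every multi index with a negative entry. -/
def hardySpace (p : ℝ≥0∞) : Set ((ℕ → Circle) → X) :=
  {f | MeasureTheory.MemLp f p polytorusMeasure ∧
    ∀ α : ℕ →₀ ℤ, (∃ j, α j < 0) → torusCoeff f α = 0}

/-- The `j`-th prime number (with `j = 0` for the prime `2`), as a positive natural number. -/
def prime (j : ℕ) : ℕ+ :=
  ⟨Nat.nth Nat.Prime j, (Nat.prime_nth_prime j).pos⟩

/-- `p ^ α = p_1 ^ α_1 ⋯ p_k ^ α_k`; by unique factorization this is a bijection from the multi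
indices onto the positive natural numbers. -/
def primePow (α : ℕ →₀ ℕ) : ℕ+ :=
  α.prod fun j k => prime j ^ k

/-- The space `𝓗_p(X)` of Dirichlet series `∑ a_n n ^ (-s)`, given by their coefficients: the image
of `H_p(𝕋 ^ ∞, X)` under the Bohr transform `a_{p ^ α} = \hat f (α)`. -/
def dirichletHardy (p : ℝ≥0∞) : Set (ℕ+ → X) :=
  {a | ∃ f ∈ hardySpace X p, ∀ α : ℕ →₀ ℕ, a (primePow α) = powerCoeff f α}

variable {X}

/-- The abscissa of absolute convergence of `∑ a_n n ^ (-s)`. -/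
def sigmaAbs (a : ℕ+ → X) : EReal :=
  ⨅ (r : ℝ) (_ : ∀ s : ℂ, r < s.re → Summable fun n : ℕ+ => ‖((n : ℕ) : ℂ) ^ (-s) • a n‖),
    (r : EReal)

/-- The infimum of all real `σ` such that `∑ (a_n / n ^ σ) n ^ (-s)` belongs to `𝓗_p(X)`. -/
def sigmaHardy (p : ℝ≥0∞) (a : ℕ+ → X) : EReal :=
  ⨅ (σ : ℝ) (_ : (fun n : ℕ+ => ((n : ℕ) : ℂ) ^ (-(σ : ℂ)) • a n) ∈ dirichletHardy X p),
    (σ : EReal)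

variable (X)

/-- The number `S_p(X)`, the supremum of `σ_a(D) - σ_{𝓗_p(X)}(D)` over all Dirichlet series `D`
in `X`. In `EReal` the undefined differences `∞ - ∞` and `(-∞) - (-∞)` are `⊥`, so that the
corresponding `D` do not contribute to the supremum. -/
def bohrStrip (p : ℝ≥0∞) : EReal :=
  ⨆ a : ℕ+ → X, sigmaAbs a - sigmaHardy p a

/-- The open unit ball of `c_0`. The modulus of a null sequence attains its supremum, so the sup
norm is less than one as soon as every entry has modulus less than one. -/
def ballC0 : Set (ℕ → ℂ) :=
  {z | Filter.Tendsto z Filter.atTop (𝓝 0) ∧ ∀ n, ‖z n‖ < 1}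

/-- The set of monomial convergence of `H_p(𝕋 ^ ∞, X)`. -/
def mon (p : ℝ≥0∞) : Set (ℕ → ℂ) :=
  {z | z ∈ ballC0 ∧ ∀ f ∈ hardySpace X p,
    Summable fun α : ℕ →₀ ℕ => ‖(α.prod fun j k => z j ^ k) • powerCoeff f α‖}

/-- The inclusion `ℓ_r ∩ B_{c_0} ⊆ mon H_p(𝕋 ^ ∞, X)`. -/
def LrSubsetMon (p r : ℝ≥0∞) : Prop :=
  {z : ℕ → ℂ | Memℓp z r} ∩ ballC0 ⊆ mon X p

/-- The number `M_p(X)`, the supremum of all `1 ≤ r ≤ ∞` with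
`ℓ_r ∩ B_{c_0} ⊆ mon H_p(𝕋 ^ ∞, X)`. -/
def monSize (p : ℝ≥0∞) : ℝ≥0∞ :=
  sSup {r : ℝ≥0∞ | 1 ≤ r ∧ LrSubsetMon X p r}

end

end VHardy

end

open scoped ENNReal Topology
open MeasureTheory

noncomputable section

namespace VHardy

/-! Everything is extracted from linear polynomials `∑ x_k w_k`. They lie in every `H_p`, their only
nonzero coefficients sit at the unit multi-indices, and up to constants their `L_p` norm is
controlled by the `L_2` norm occurring in the definition of cotype (Khinchine-Kahane).

If nonnegative weights `z_k` make `∑ z_k ‖f̂(e_k)‖` finite for every `f` in `H_p`, uniform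
boundedness on this Banach space and Kahane's inequality give `∑ z_k ‖x_k‖ ≤ C ‖∑ x_k w_k‖_2` for
all finite families (`exists_sum_mul_norm_le`). Both halves of the theorem start from this estimate.

For monomial convergence, the weights run through `ℓ_r`. A second application of uniform boundedness
makes `C` proportional to `‖z‖_r`, and duality between `ℓ_r` and `ℓ_{r'}` turns the estimate into
cotype `r'` (`LrSubsetMon.cotypeIneq`). Constant families show that the exponent is at least 2. The
bound on `M_p(X)` follows because conjugation reverses order.

For Dirichlet series, the weights are `p_k ^ (-σ)` with `σ` above all abscissae. Chebyshev's bound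
replaces them by `(k + 1) ^ (-τ)` for any `τ > σ`. Rearranging the `x_k` by decreasing norm gives a
weak `ℓ_{1/(1-τ)}` estimate, hence cotype `q` for every `q > 1/(1-τ)` (`cotypeIneq_of_sum_rpow_le`).
If `σ` could be below `1 - 1/cot X`, this would contradict the definition of `cot X`. -/

instance : circleMeasure.IsHaarMeasure := by unfold circleMeasure; infer_instance

instance (N : ℕ) : IsProbabilityMeasure (torusMeasure N) := by unfold torusMeasure; infer_instance

instance : IsProbabilityMeasure polytorusMeasure := by unfold polytorusMeasure; infer_instance

/-! ### Invariance of the torus measures and orthogonality of monomials. -/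

lemma measurePreserving_circle_mul (u : Circle) :
    MeasurePreserving (fun w => u * w) circleMeasure circleMeasure :=
  measurePreserving_mul_left _ u

lemma measurePreserving_polytorus_mul (u : ℕ → Circle) :
    MeasurePreserving (fun w => u * w) polytorusMeasure polytorusMeasure := by
  refine ⟨by fun_prop, ?_⟩
  have h := Measure.infinitePi_map_pi (μ := fun _ : ℕ => circleMeasure)
    (f := fun i w => u i * w) (fun i => by fun_prop)
  simp only [(measurePreserving_circle_mul _).map_eq] at h
  exact h

lemma measurePreserving_polytorus_torus (N : ℕ) :
    MeasurePreserving (fun (w : ℕ → Circle) (k : Fin N) => w k)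
      polytorusMeasure (torusMeasure N) := by
  refine ⟨by fun_prop, ?_⟩
  refine (Measure.pi_eq fun s hs => ?_).symm
  rw [Measure.map_apply (by fun_prop) (MeasurableSet.univ_pi hs)]
  let t : ℕ → Set Circle := fun k => if h : k < N then s ⟨k, h⟩ else Set.univ
  have ht : ∀ i ∈ Finset.range N, MeasurableSet (t i) := by
    intro i hi
    simp only [Finset.mem_range] at hi
    simp only [t, hi, dif_pos, hs]
  have : (fun (w : ℕ → Circle) (k : Fin N) => w k) ⁻¹' Set.univ.pi s
      = Set.pi (Finset.range N) t := by
    ext w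
    simp only [Set.mem_preimage, Set.mem_pi, Set.mem_univ, true_imp_iff, Finset.coe_range,
      Set.mem_Iio]
    constructor
    · intro h i hi
      simpa [t, hi] using h ⟨i, hi⟩
    · intro h i
      simpa [t] using h i i.2
  rw [this, polytorusMeasure, Measure.infinitePi_pi _ ht, Finset.prod_range]
  refine Finset.prod_congr rfl fun i _ => ?_
  simp [t]

lemma torusMonomial_mul (α : ℕ →₀ ℤ) (u w : ℕ → Circle) :
    torusMonomial α (u * w) = torusMonomial α u * torusMonomial α w := by
  simp [torusMonomial, Finsupp.prod, mul_zpow, Finset.prod_mul_distrib]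

lemma torusMonomial_add (α β : ℕ →₀ ℤ) (w : ℕ → Circle) :
    torusMonomial (α + β) w = torusMonomial α w * torusMonomial β w := by
  unfold torusMonomial
  exact Finsupp.prod_add_index' (by simp) fun j a b => zpow_add₀ (Circle.coe_ne_zero _) a b

lemma torusMonomial_single (k : ℕ) (w : ℕ → Circle) :
    torusMonomial (Finsupp.single k 1) w = w k := by
  simp [torusMonomial]

lemma norm_torusMonomial (α : ℕ →₀ ℤ) (w : ℕ → Circle) : ‖torusMonomial α w‖ = 1 := by
  simp only [torusMonomial, Finsupp.prod, norm_prod, norm_zpow, Circle.norm_coe, one_zpow,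
    Finset.prod_const_one]

lemma continuous_torusMonomial (α : ℕ →₀ ℤ) : Continuous (torusMonomial α) := by
  unfold torusMonomial Finsupp.prod
  refine continuous_finsetProd _ fun i _ => ?_
  refine Continuous.zpow₀ (by fun_prop) _ fun w => Or.inl (Circle.coe_ne_zero _)

lemma exists_circle_zpow_ne_one {n : ℤ} (hn : n ≠ 0) : ∃ u : Circle, (u : ℂ) ^ n ≠ 1 := by
  -- The `n`-th power of this point is `e^i`, whose real part `cos 1` is below 1.
  refine ⟨Circle.exp (1 / n), fun h => ?_⟩
  rw [← Circle.coe_zpow, ← Circle.exp_zsmul] at h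
  have hn' : (n : ℝ) ≠ 0 := by exact_mod_cast hn
  have h1 : n • (1 / (n : ℝ)) = 1 := by simp [hn']
  rw [h1] at h
  have h2 : Complex.exp (1 * Complex.I) = 1 := by simpa [Circle.coe_exp] using h
  have := congrArg Complex.re h2
  rw [one_mul, ← Complex.ofReal_one, ] at this
  have h3 : Real.cos 1 = 1 := by
    simpa [Complex.exp_re] using this
  have := Real.cos_one_le
  norm_num at this
  linarith

/-- If `α j ≠ 0`, rotating the `j`-th coordinate by `u` preserves the measure but multiplies the
integrand by `u ^ α j`, which can be made different from 1. -/
lemma integral_torusMonomial (α : ℕ →₀ ℤ) :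
    ∫ w, torusMonomial α w ∂polytorusMeasure = if α = 0 then 1 else 0 := by
  split_ifs with h
  · subst h
    simp [torusMonomial]
  · obtain ⟨j, hj⟩ := Finsupp.ne_iff.1 h
    obtain ⟨u, hu⟩ := exists_circle_zpow_ne_one hj
    have h1 : torusMonomial α (Pi.mulSingle j u) = (u : ℂ) ^ α j := by
      unfold torusMonomial Finsupp.prod
      rw [Finset.prod_eq_single j]
      · simp
      · intro i _ hi
        simp [Pi.mulSingle_eq_of_ne hi]
      · intro hj'
        simp [Finsupp.notMem_support_iff.1 hj']
    have h2 := (measurePreserving_polytorus_mul (Pi.mulSingle j u)).integral_comp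
      (MeasurableEquiv.mulLeft _).measurableEmbedding (torusMonomial α)
    simp only [torusMonomial_mul, h1, integral_const_mul] at h2
    have h3 : ((u : ℂ) ^ α j - 1) * ∫ w, torusMonomial α w ∂polytorusMeasure = 0 := by
      rw [sub_mul, h2, one_mul, sub_self]
    exact (mul_eq_zero.1 h3).resolve_left (sub_ne_zero.2 hu)

/-! ### Linear polynomials, their Fourier coefficients and their `L_2` norms. -/

section

variable {X : Type*} [NormedAddCommGroup X] [NormedSpace ℂ X]

/-- The linear polynomial `∑ x_k z_k` on the finite dimensional polytorus. -/
def linPoly {N : ℕ} (x : Fin N → X) (z : Fin N → Circle) : X := ∑ k, (z k : ℂ) • x k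

/-- The `L_2` norm of the linear polynomial `∑ x_k z_k`. -/
def linNorm {N : ℕ} (x : Fin N → X) : ℝ :=
  (∫ z, ‖∑ k, (z k : ℂ) • x k‖ ^ 2 ∂(torusMeasure N)) ^ (1 / 2 : ℝ)

lemma continuous_linPoly {N : ℕ} (x : Fin N → X) : Continuous (linPoly x) := by
  unfold linPoly; fun_prop

lemma memLp_linPoly {N : ℕ} (x : Fin N → X) (p : ℝ≥0∞) : MemLp (linPoly x) p (torusMeasure N) := by
  obtain ⟨C, hC⟩ := (isCompact_range (continuous_linPoly x)).isBounded.exists_norm_le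
  exact MemLp.of_bound (continuous_linPoly x).aestronglyMeasurable C
    (ae_of_all _ fun z => hC _ ⟨z, rfl⟩)

/-- The linear polynomial `∑ x_k w_k` on the infinite dimensional polytorus. -/
def linFun {N : ℕ} (x : Fin N → X) (w : ℕ → Circle) : X := linPoly x fun k => w k

lemma memLp_linFun {N : ℕ} (x : Fin N → X) (p : ℝ≥0∞) : MemLp (linFun x) p polytorusMeasure :=
  (memLp_linPoly x p).comp_measurePreserving (measurePreserving_polytorus_torus N)

lemma eLpNorm_linFun {N : ℕ} (x : Fin N → X) (p : ℝ≥0∞) :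
    eLpNorm (linFun x) p polytorusMeasure = eLpNorm (linPoly x) p (torusMeasure N) :=
  eLpNorm_comp_measurePreserving (memLp_linPoly x p).1 (measurePreserving_polytorus_torus N)

lemma torusCoeff_linFun [CompleteSpace X] {N : ℕ} (x : Fin N → X) (α : ℕ →₀ ℤ) :
    torusCoeff (linFun x) α = ∑ k : Fin N, if α = Finsupp.single (k : ℕ) 1 then x k else 0 := by
  have h1 : ∀ w, torusMonomial (-α) w • linFun x w
      = ∑ k : Fin N, torusMonomial (-α + Finsupp.single (k : ℕ) 1) w • x k := by
    intro w
    simp only [linFun, linPoly, Finset.smul_sum, smul_smul, torusMonomial_add,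
      torusMonomial_single]
  have hint : ∀ β, Integrable (torusMonomial β) polytorusMeasure := fun β =>
    Integrable.of_bound (continuous_torusMonomial β).aestronglyMeasurable 1
      (ae_of_all _ fun w => (norm_torusMonomial β w).le)
  unfold torusCoeff
  simp only [h1]
  rw [integral_finsetSum _ fun k _ => (hint _).smul_const _]
  refine Finset.sum_congr rfl fun k _ => ?_
  rw [integral_smul_const, integral_torusMonomial]
  have : -α + Finsupp.single (k : ℕ) 1 = 0 ↔ α = Finsupp.single (k : ℕ) 1 := by
    rw [neg_add_eq_zero]
  simp only [this]
  split_ifs <;> simp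

lemma linFun_mem_hardySpace [CompleteSpace X] {N : ℕ} (x : Fin N → X) (p : ℝ≥0∞) :
    linFun x ∈ hardySpace X p := by
  refine ⟨memLp_linFun x p, fun α ⟨j, hj⟩ => ?_⟩
  rw [torusCoeff_linFun]
  refine Finset.sum_eq_zero fun k _ => if_neg ?_
  rintro rfl
  by_cases h : (k : ℕ) = j
  · simp [h] at hj
  · simp [h] at hj

lemma torusCoeff_linFun_single [CompleteSpace X] {N : ℕ} (x : Fin N → X) (k : Fin N) :
    torusCoeff (linFun x) (Finsupp.single (k : ℕ) 1) = x k := by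
  rw [torusCoeff_linFun, Finset.sum_eq_single k]
  · simp
  · intro b _ hb
    rw [if_neg]
    intro h
    have := Finsupp.single_left_injective (one_ne_zero) h
    exact hb (Fin.ext this.symm)
  · simp

lemma powerCoeff_single (f : (ℕ → Circle) → X) (k : ℕ) :
    powerCoeff f (Finsupp.single k 1) = torusCoeff f (Finsupp.single k 1) := by
  simp [powerCoeff]

lemma linNorm_nonneg {N : ℕ} (x : Fin N → X) : 0 ≤ linNorm x :=
  Real.rpow_nonneg (integral_nonneg fun _ => by positivity) _

lemma linNorm_sq {N : ℕ} (x : Fin N → X) :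
    linNorm x ^ 2 = ∫ z, ‖linPoly x z‖ ^ 2 ∂(torusMeasure N) := by
  unfold linNorm
  rw [← Real.sqrt_eq_rpow, Real.sq_sqrt (integral_nonneg fun _ => by positivity)]
  rfl

lemma linNorm_smul {N : ℕ} (c : ℂ) (x : Fin N → X) : linNorm (c • x) = ‖c‖ * linNorm x := by
  rw [← sq_eq_sq₀ (linNorm_nonneg _) (by have := linNorm_nonneg x; positivity), mul_pow,
    linNorm_sq, linNorm_sq, ← integral_const_mul]
  congr 1 with z
  rw [← mul_pow, ← norm_smul]
  simp only [linPoly, Finset.smul_sum, Pi.smul_apply, smul_comm c]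

lemma linNorm_comp_perm {N : ℕ} (σ : Equiv.Perm (Fin N)) (x : Fin N → X) :
    linNorm (x ∘ σ) = linNorm x := by
  rw [← sq_eq_sq₀ (linNorm_nonneg _) (linNorm_nonneg _), linNorm_sq, linNorm_sq]
  have h := measurePreserving_piCongrLeft (fun _ : Fin N => circleMeasure) σ
  have h2 := h.integral_comp (MeasurableEquiv.measurableEmbedding _)
    (fun z => ‖linPoly x z‖ ^ 2)
  refine Eq.trans ?_ h2
  unfold torusMeasure
  congr 1 with z
  congr 2
  unfold linPoly
  conv_rhs => rw [← Equiv.sum_comp σ]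
  refine Finset.sum_congr rfl fun k _ => ?_
  congr 2
  exact (Equiv.piCongrLeft_apply_apply (P := fun _ : Fin N => Circle) σ z k).symm

end

/-! ### The Khinchine-Kahane inequality by hypercontractivity. -/

/-- A second-order Taylor bound. The factor `M ^ 2` keeps exponents nonnegative, so the induction
can start at `n = 0`. In the induction step the new quadratic coefficient is at most `n + 4 ^ n + 4
^ n`, the cubic term being absorbed by `t ≤ M`, and `n ≤ 4 ^ n`. -/
lemma add_pow_mul_sq_le {M t : ℝ} (hM : |t| ≤ M) (n : ℕ) :
    (M + t) ^ n * M ^ 2 ≤ M ^ (n + 2) + n * M ^ (n + 1) * t + 4 ^ n * M ^ n * t ^ 2 := by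
  obtain ⟨h1, h2⟩ := abs_le.1 hM
  have hM0 : 0 ≤ M := (abs_nonneg t).trans hM
  induction n with
  | zero => simp; nlinarith [sq_nonneg t]
  | succ n ih =>
    have h3 : (M + t) ^ (n + 1) * M ^ 2 = (M + t) * ((M + t) ^ n * M ^ 2) := by ring
    rw [h3]
    refine (mul_le_mul_of_nonneg_left ih (by linarith)).trans ?_
    have hn : (n : ℝ) ≤ 4 ^ n := by exact_mod_cast (Nat.lt_pow_self (by norm_num)).le
    have h4 : (n : ℝ) * M ^ (n + 1) * t ^ 2 ≤ 4 ^ n * M ^ (n + 1) * t ^ 2 := by gcongr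
    have h5 : (4 : ℝ) ^ n * M ^ n * t ^ 2 * t ≤ 4 ^ n * M ^ n * t ^ 2 * M := by gcongr
    have h6 : 0 ≤ (4 : ℝ) ^ n * M ^ (n + 1) * t ^ 2 := by positivity
    push_cast
    ring_nf at h4 h5 h6 ⊢
    nlinarith

lemma add_pow_le {M t : ℝ} (hM : |t| ≤ M) (m : ℕ) (hm : m ≠ 0) :
    (M + t) ^ (2 * m) ≤
      M ^ (2 * m) + (2 * m) * M ^ (2 * m - 1) * t + 16 ^ m * M ^ (2 * m - 2) * t ^ 2 := by
  have hM0 : 0 ≤ M := (abs_nonneg t).trans hM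
  rcases hM0.eq_or_lt with h | h
  · subst h
    obtain rfl : t = 0 := by simpa using hM
    simp [hm]
  · have := add_pow_mul_sq_le hM (2 * m)
    obtain ⟨m, rfl⟩ := Nat.exists_eq_succ_of_ne_zero hm
    refine le_of_mul_le_mul_right (this.trans (le_of_eq ?_)) (pow_pos h 2)
    have e1 : 2 * m.succ - 1 = 2 * m + 1 := by omega
    have e2 : 2 * m.succ - 2 = 2 * m := by omega
    rw [e1, e2, pow_mul 4 2]
    norm_num
    ring

lemma integrable_of_continuous {K : Type*} [TopologicalSpace K] [CompactSpace K]
    [MeasurableSpace K] [BorelSpace K] (μ : Measure K) [IsFiniteMeasure μ] {g : K → ℝ}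
    (hg : Continuous g) : Integrable g μ := by
  obtain ⟨C, hC⟩ := (isCompact_range hg).isBounded.exists_norm_le
  exact Integrable.of_bound hg.aestronglyMeasurable C (ae_of_all _ fun z => hC _ ⟨z, rfl⟩)

section

variable {X : Type*} [NormedAddCommGroup X] [NormedSpace ℂ X]

lemma integral_quadratic {Ω : Type*} [MeasurableSpace Ω] {μ : Measure Ω} [IsProbabilityMeasure μ]
    {f k : Ω → ℝ} (hf : Integrable f μ) (hk : Integrable k μ) (a b c : ℝ) :
    ∫ w, (a + b * f w + c * k w) ∂μ = a + b * ∫ w, f w ∂μ + c * ∫ w, k w ∂μ := by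
  have h1 := integral_add (f := fun w => a + b * f w) ((integrable_const a).add (hf.const_mul b))
    (hk.const_mul c)
  have h2 := integral_add (integrable_const (μ := μ) a) (hf.const_mul b)
  rw [h1, h2, integral_const_mul, integral_const_mul]
  simp

/-- Averaging over `w` and `-w`: both `2a` and `2wb` are combinations, with coefficients `±1`, of `a
+ wb` and `a - wb`. -/
lemma norm_le_integral_circle (a b : X) :
    ‖a‖ ≤ ∫ w : Circle, ‖a + (w : ℂ) • b‖ ∂circleMeasure ∧
      ‖b‖ ≤ ∫ w : Circle, ‖a + (w : ℂ) • b‖ ∂circleMeasure := by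
  set g : Circle → ℝ := fun w => ‖a + (w : ℂ) • b‖
  have hg : Continuous g := by fun_prop
  have hi := integrable_of_continuous circleMeasure hg
  have hneg : ∫ w, g (-1 * w) ∂circleMeasure = ∫ w, g w ∂circleMeasure :=
    (measurePreserving_circle_mul (-1)).integral_comp
      (MeasurableEquiv.mulLeft _).measurableEmbedding g
  have hi' : Integrable (fun w => g (-1 * w)) circleMeasure :=
    integrable_of_continuous circleMeasure (hg.comp (by fun_prop))
  have hsum : ∫ w, (g w + g (-1 * w)) ∂circleMeasure = 2 * ∫ w, g w ∂circleMeasure := by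
    rw [integral_add hi hi', hneg]; ring
  have key : ∀ c : ℝ, (∀ w, 2 * c ≤ g w + g (-1 * w)) → c ≤ ∫ w, g w ∂circleMeasure := by
    intro c hc
    have : ∫ _ : Circle, 2 * c ∂circleMeasure ≤ ∫ w, (g w + g (-1 * w)) ∂circleMeasure :=
      integral_mono (integrable_const _) (hi.add hi') hc
    rw [hsum] at this
    simp at this
    exact this
  constructor
  · refine key _ fun w => ?_
    have : ‖(2 : ℂ) • a‖ ≤ g w + g (-1 * w) := by
      refine le_trans (le_of_eq ?_) (norm_add_le _ _)
      congr 1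
      simp only [Circle.coe_mul, Circle.coe_neg, Circle.coe_one, two_smul]
      module
    simpa [norm_smul] using this
  · refine key _ fun w => ?_
    have : ‖((2 : ℂ) * w) • b‖ ≤ g w + g (-1 * w) := by
      refine le_trans (le_of_eq ?_) (norm_sub_le _ _)
      congr 1
      simp only [Circle.coe_mul, Circle.coe_neg, Circle.coe_one]
      module
    simpa [norm_smul, Circle.norm_coe] using this

/-- A one variable hypercontractive inequality. -/
lemma integral_circle_pow_le (m : ℕ) (hm : m ≠ 0) (a b : X) :
    ∫ w : Circle, ‖a + (((4 ^ m : ℝ)⁻¹ : ℝ) : ℂ) • (w : ℂ) • b‖ ^ (2 * m) ∂circleMeasure ≤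
      (∫ w : Circle, ‖a + (w : ℂ) • b‖ ^ 2 ∂circleMeasure) ^ m := by
  obtain ⟨hA, hB⟩ := norm_le_integral_circle a b
  set g : Circle → ℝ := fun w => ‖a + (w : ℂ) • b‖ with hgdef
  have hg : Continuous g := by fun_prop
  set M := ∫ w, g w ∂circleMeasure
  set ρ : ℝ := (4 ^ m : ℝ)⁻¹ with hρ
  have hρ0 : 0 < ρ := by positivity
  have hρ1 : ρ ≤ 1 := inv_le_one_of_one_le₀ (one_le_pow₀ (by norm_num))
  -- This is what fixes `ρ = 4 ^ (-m)`: it cancels the constant of the quadratic term in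
  -- `add_pow_le`.
  have hρ2 : 16 ^ m * ρ ^ 2 = 1 := by
    rw [hρ, inv_pow, ← pow_mul, mul_comm m 2, pow_mul]
    norm_num
  have hM0 : 0 ≤ M := (norm_nonneg _).trans hA
  -- Both `‖a‖` and `‖b‖` are at most the mean `M`, so `g` takes values in `[0, 2M]`.
  have hgM : ∀ w, |g w - M| ≤ M := by
    intro w
    have h1 : g w ≤ ‖a‖ + ‖b‖ := by
      refine (norm_add_le _ _).trans ?_
      simp [norm_smul, Circle.norm_coe]
    have h2 : 0 ≤ g w := norm_nonneg _
    rw [abs_le]; constructor <;> linarith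
  -- Convexity: the vector is `(1 - ρ) a + ρ (a + wb)`. The deviation `g - M` has mean zero, so only
  -- its variance `H` will survive integration.
  have hpt : ∀ w : Circle, ‖a + (ρ : ℂ) • (w : ℂ) • b‖ ≤ M + ρ * (g w - M) := by
    intro w
    have : a + (ρ : ℂ) • (w : ℂ) • b = ((1 - ρ : ℝ) : ℂ) • a + (ρ : ℂ) • (a + (w : ℂ) • b) := by
      push_cast
      module
    rw [this]
    refine (norm_add_le _ _).trans ?_
    rw [norm_smul, norm_smul, Complex.norm_real, Complex.norm_real, Real.norm_of_nonneg hρ0.le,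
      Real.norm_of_nonneg (by linarith)]
    have : (1 - ρ) * ‖a‖ ≤ (1 - ρ) * M := mul_le_mul_of_nonneg_left hA (by linarith)
    simp only [hgdef] at *
    linarith
  have hpt2 : ∀ w : Circle, ‖a + (ρ : ℂ) • (w : ℂ) • b‖ ^ (2 * m) ≤
      M ^ (2 * m) + (2 * m) * M ^ (2 * m - 1) * ρ * (g w - M) + M ^ (2 * m - 2) * (g w - M) ^ 2 := by
    intro w
    refine (pow_le_pow_left₀ (norm_nonneg _) (hpt w) _).trans ?_
    have h1 : |ρ * (g w - M)| ≤ M := by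
      rw [abs_mul, abs_of_pos hρ0]
      exact (mul_le_of_le_one_left (abs_nonneg _) hρ1).trans (hgM w)
    refine (add_pow_le h1 m hm).trans (le_of_eq ?_)
    linear_combination (M ^ (2 * m - 2) * (g w - M) ^ 2) * hρ2
  have hi := integrable_of_continuous circleMeasure hg
  have hi2 : Integrable (fun w => g w ^ 2) circleMeasure :=
    integrable_of_continuous circleMeasure (by fun_prop)
  have hi3 : Integrable (fun w => (g w - M) ^ 2) circleMeasure :=
    integrable_of_continuous circleMeasure (by fun_prop)
  have hi4 : Integrable (fun w => g w - M) circleMeasure :=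
    integrable_of_continuous circleMeasure (by fun_prop)
  set H := ∫ w, (g w - M) ^ 2 ∂circleMeasure with hH
  have hH0 : 0 ≤ H := integral_nonneg fun _ => sq_nonneg _
  have hz : ∫ w, (g w - M) ∂circleMeasure = 0 := by
    rw [integral_sub hi (integrable_const _)]
    simp [M]
  have hsq : ∫ w, g w ^ 2 ∂circleMeasure = M ^ 2 + H := by
    have : ∀ w, g w ^ 2 = M ^ 2 + (2 * M) * (g w - M) + (g w - M) ^ 2 := fun w => by ring
    simp only [this]
    have h := integral_quadratic hi4 hi3 (M ^ 2) (2 * M) 1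
    simp only [one_mul, hz, ← hH, mul_zero, add_zero] at h
    exact h
  calc _ ≤ ∫ w, (M ^ (2 * m) + (2 * m) * M ^ (2 * m - 1) * ρ * (g w - M)
        + M ^ (2 * m - 2) * (g w - M) ^ 2) ∂circleMeasure :=
        integral_mono (integrable_of_continuous _ (by fun_prop))
          (integrable_of_continuous _ (by fun_prop)) hpt2
    _ = M ^ (2 * m) + M ^ (2 * m - 2) * H := by
      rw [integral_quadratic hi4 hi3, hz, mul_zero, add_zero]
    -- Mean squared plus variance is the second moment; the left side consists of `(M ^ 2) ^ (m -
    -- 1)` times that moment.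
    _ ≤ (M ^ 2 + H) ^ m := by
      obtain ⟨m, rfl⟩ := Nat.exists_eq_succ_of_ne_zero hm
      have e2 : 2 * m.succ - 2 = 2 * m := by omega
      have h7 : (M ^ 2) ^ m ≤ (M ^ 2 + H) ^ m := pow_le_pow_left₀ (by positivity) (by linarith) _
      have h8 : 0 ≤ M ^ 2 + H := by positivity
      rw [e2, pow_succ]
      calc M ^ (2 * m.succ) + M ^ (2 * m) * H = (M ^ 2) ^ m * (M ^ 2 + H) := by
            rw [pow_mul, pow_mul, pow_succ]; ring
        _ ≤ _ := by gcongr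
    _ = (∫ w, g w ^ 2 ∂circleMeasure) ^ m := by rw [hsq]

end

lemma integral_torus_succ {N : ℕ} (F : (Fin (N + 1) → Circle) → ℝ) (hF : Continuous F) :
    ∫ z, F z ∂(torusMeasure (N + 1)) =
      ∫ z, ∫ w, F (Fin.cons w z) ∂circleMeasure ∂(torusMeasure N) := by
  have h := measurePreserving_piFinSuccAbove (fun _ : Fin (N + 1) => circleMeasure) 0
  have h2 := (h.symm _).integral_comp (MeasurableEquiv.measurableEmbedding _) F
  have hs : ∀ q : Circle × (Fin N → Circle),
      (MeasurableEquiv.piFinSuccAbove (fun _ : Fin (N + 1) => Circle) 0).symm q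
        = Fin.cons q.1 q.2 := fun q => Fin.insertNth_zero' q.1 q.2
  have hc : Continuous fun q : Circle × (Fin N → Circle) =>
      F ((MeasurableEquiv.piFinSuccAbove (fun _ : Fin (N + 1) => Circle) 0).symm q) := by
    refine hF.comp ?_
    rw [funext hs]
    fun_prop
  unfold torusMeasure
  rw [← h2, integral_prod_symm _ (integrable_of_continuous _ hc)]
  congr 1 with z
  congr 1 with w
  rw [hs]

/-- A Khinchine-Kahane inequality for Steinhaus polynomials of degree one, in hypercontractive
form. -/
lemma integral_torus_pow_le (m : ℕ) (hm : m ≠ 0) (N : ℕ) {X : Type*} [NormedAddCommGroup X]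
    [NormedSpace ℂ X] (a : X) (x : Fin N → X) :
    ∫ z, ‖a + (((4 ^ m : ℝ)⁻¹ : ℝ) : ℂ) • linPoly x z‖ ^ (2 * m) ∂(torusMeasure N) ≤
      (∫ z, ‖a + linPoly x z‖ ^ 2 ∂(torusMeasure N)) ^ m := by
  induction N generalizing X with
  | zero => simp [linPoly, pow_mul]
  | succ N ih =>
    set ρ : ℂ := (((4 ^ m : ℝ)⁻¹ : ℝ) : ℂ)
    have hcons : ∀ (w : Circle) (z : Fin N → Circle), linPoly x (Fin.cons w z : Fin (N + 1) → Circle)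
        = (w : ℂ) • x 0 + linPoly (fun k => x k.succ) z := by
      intro w z
      simp [linPoly, Fin.sum_univ_succ]
    have hcx := continuous_linPoly x
    have hcx' := continuous_linPoly (fun k => x k.succ)
    rw [integral_torus_succ _ (by fun_prop), integral_torus_succ _ (by fun_prop)]
    simp only [hcons]
    -- The first variable is hidden in the target space: the induction hypothesis is applied to
    -- coefficients in `L_2(𝕋, X)`, which is why the induction generalizes over `X`. This takes the
    -- place of Minkowski's inequality for mixed norms.
    let T := ContinuousMap.toLp (E := X) 2 circleMeasure ℂ
    have hT : ∀ f : C(Circle, X), ‖T f‖ ^ 2 = ∫ w, ‖f w‖ ^ 2 ∂circleMeasure := by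
      intro f
      rw [Lp.norm_def, MemLp.eLpNorm_eq_integral_rpow_norm (by norm_num) (by norm_num) (Lp.memLp _)]
      rw [ENNReal.toReal_ofReal (by positivity)]
      have : (2 : ℝ≥0∞).toReal = 2 := by simp
      rw [this, ← one_div, ← Real.sqrt_eq_rpow, Real.sq_sqrt (integral_nonneg fun _ => by positivity)]
      refine integral_congr_ae ?_
      filter_upwards [ContinuousMap.coeFn_toLp (p := 2) (𝕜 := ℂ) circleMeasure f] with w hw
      simp only [T, hw, Real.rpow_two]
    let c : X → C(Circle, X) := fun v => ContinuousMap.const _ v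
    let A : C(Circle, X) := ⟨fun w => a + (w : ℂ) • x 0, by fun_prop⟩
    have hlin : ∀ (s : ℂ) z, T A + s • linPoly (fun k : Fin N => T (c (x k.succ))) z
        = T (A + s • c (linPoly (fun k => x k.succ) z)) := by
      intro s z
      rw [map_add, map_smul]
      congr 2
      simp only [linPoly, ← map_smul, ← map_sum]
      congr 1
      ext w
      simp [c]
    have h2 := ih (T A) (fun k => T (c (x k.succ)))
    have h3 : ∀ z, T A + linPoly (fun k : Fin N => T (c (x k.succ))) z
        = T (A + c (linPoly (fun k => x k.succ) z)) := by
      intro z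
      simpa using hlin 1 z
    simp only [hlin, h3, pow_mul, hT] at h2
    have hcont : Continuous fun q : (Fin N → Circle) × Circle =>
        ‖a + ρ • ((q.2 : ℂ) • x 0 + linPoly (fun k => x k.succ) q.1)‖ ^ (2 * m) := by
      fun_prop
    have hcont2 : Continuous fun q : (Fin N → Circle) × Circle =>
        ‖(A + ρ • c (linPoly (fun k => x k.succ) q.1)) q.2‖ ^ 2 := by
      simp only [ContinuousMap.add_apply, ContinuousMap.smul_apply, A, c,
        ContinuousMap.coe_mk, ContinuousMap.const_apply]
      fun_prop
    refine le_trans (integral_mono ?_ ?_ fun z => ?_) (h2.trans_eq ?_)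
    · exact (integrable_of_continuous ((torusMeasure N).prod circleMeasure) hcont).integral_prod_left
    · refine integrable_of_continuous _ (Continuous.pow ?_ m)
      have := continuous_parametric_integral_of_continuous (μ := circleMeasure)
        (f := fun (z : Fin N → Circle) (w : Circle) =>
          ‖(A + ρ • c (linPoly (fun k => x k.succ) z)) w‖ ^ 2) hcont2 isCompact_univ
      simpa using this
    -- With the remaining variables frozen, the one-variable inequality handles the first one.
    · have := integral_circle_pow_le m hm (a + ρ • linPoly (fun k => x k.succ) z) (x 0)
      refine le_trans (le_of_eq ?_) (this.trans_eq ?_)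
      · congr 1 with w
        congr 2
        rw [add_assoc, ← smul_add, add_comm ((w : ℂ) • x 0)]
      · congr 2 with w
        congr 2
        simp only [ContinuousMap.add_apply, ContinuousMap.smul_apply, A, c,
          ContinuousMap.coe_mk, ContinuousMap.const_apply]
        module
    · congr 2 with z
      congr 1 with w
      simp [A, c, add_assoc]

/-- Raise `p` to an even integer `2m`, apply the hypercontractive inequality with `a = 0`, and pull
out `ρ` by homogeneity; the constant is `ρ⁻¹ = 4 ^ m`. -/
lemma exists_eLpNorm_linPoly_le (X : Type*) [NormedAddCommGroup X] [NormedSpace ℂ X]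
    {p : ℝ≥0∞} (hp : p ≠ ⊤) : ∃ C : ℝ, 0 < C ∧ ∀ (N : ℕ) (x : Fin N → X),
      (eLpNorm (linPoly x) p (torusMeasure N)).toReal ≤ C * linNorm x := by
  obtain ⟨n, hn⟩ := ENNReal.exists_nat_gt hp
  set m := n + 1
  refine ⟨4 ^ m, by positivity, fun N x => ?_⟩
  have hpm : p ≤ ((2 * m : ℕ) : ℝ≥0∞) := hn.le.trans (by exact_mod_cast (by omega))
  have hm : 2 * m ≠ 0 := by omega
  have h1 := eLpNorm_le_eLpNorm_of_exponent_le hpm (memLp_linPoly x p).1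
  have hfin := memLp_linPoly x ((2 * m : ℕ) : ℝ≥0∞)
  refine (ENNReal.toReal_mono hfin.2.ne h1).trans ?_
  rw [hfin.eLpNorm_eq_integral_rpow_norm (by exact_mod_cast hm) (ENNReal.natCast_ne_top _),
    ENNReal.toReal_ofReal (by positivity), ENNReal.toReal_natCast]
  have h2 := integral_torus_pow_le m (by omega) N 0 x
  have h0 := linNorm_nonneg x
  simp only [zero_add, ← linNorm_sq, ← pow_mul, norm_smul, mul_pow, integral_const_mul] at h2
  rw [Complex.norm_real, Real.norm_of_nonneg (by positivity), inv_pow,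
    inv_mul_le_iff₀ (by positivity), ← mul_pow] at h2
  simp only [Real.rpow_natCast]
  calc _ ≤ ((4 ^ m * linNorm x) ^ (2 * m)) ^ (((2 * m : ℕ) : ℝ)⁻¹) :=
        Real.rpow_le_rpow (integral_nonneg fun _ => by positivity) h2 (by positivity)
    _ = _ := Real.pow_rpow_inv_natCast (by positivity) hm

/-! ### The Hardy space as a Banach space and the first uniform boundedness argument. -/

section

variable {X : Type*} [NormedAddCommGroup X] [NormedSpace ℂ X]

lemma torusCoeff_congr_ae {f g : (ℕ → Circle) → X} (h : f =ᵐ[polytorusMeasure] g) (α : ℕ →₀ ℤ) :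
    torusCoeff f α = torusCoeff g α := by
  refine integral_congr_ae ?_
  filter_upwards [h] with w hw
  rw [hw]

lemma integrable_torusMonomial_smul {f : (ℕ → Circle) → X} (hf : Integrable f polytorusMeasure)
    (α : ℕ →₀ ℤ) : Integrable (fun w => torusMonomial α w • f w) polytorusMeasure :=
  hf.bdd_smul 1 (continuous_torusMonomial α).aestronglyMeasurable
    (ae_of_all _ fun w => (norm_torusMonomial α w).le)

/-- The Fourier coefficient as a continuous linear map on `L_p`. -/
def coeffCLM (X : Type*) [NormedAddCommGroup X] [NormedSpace ℂ X] (p : ℝ≥0∞) [Fact (1 ≤ p)]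
    (α : ℕ →₀ ℤ) : Lp X p polytorusMeasure →L[ℂ] X :=
  LinearMap.mkContinuous
    { toFun := fun f => torusCoeff f α
      map_add' := fun f g => by
        rw [torusCoeff_congr_ae (Lp.coeFn_add f g)]
        unfold torusCoeff
        simp only [Pi.add_apply, smul_add]
        exact integral_add
          (integrable_torusMonomial_smul ((Lp.memLp f).integrable Fact.out) _)
          (integrable_torusMonomial_smul ((Lp.memLp g).integrable Fact.out) _)
      map_smul' := fun c f => by
        rw [torusCoeff_congr_ae (Lp.coeFn_smul c f)]
        unfold torusCoeff
        simp only [Pi.smul_apply, smul_comm _ c, integral_smul, RingHom.id_apply] } 1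
    fun f => by
      rw [one_mul]
      have h1 : ‖torusCoeff f α‖ ≤ ∫ w, ‖f w‖ ∂polytorusMeasure := by
        refine (norm_integral_le_integral_norm _).trans_eq ?_
        simp only [norm_smul, norm_torusMonomial, one_mul]
      have h2 : eLpNorm f 1 polytorusMeasure ≤ eLpNorm f p polytorusMeasure :=
        eLpNorm_le_eLpNorm_of_exponent_le Fact.out (Lp.aestronglyMeasurable f)
      refine h1.trans ?_
      rw [integral_norm_eq_lintegral_enorm (Lp.aestronglyMeasurable f), Lp.norm_def,
        ← eLpNorm_one_eq_lintegral_enorm]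
      exact ENNReal.toReal_mono (Lp.memLp f).2.ne h2

lemma coeffCLM_apply (p : ℝ≥0∞) [Fact (1 ≤ p)] (α : ℕ →₀ ℤ) (f : Lp X p polytorusMeasure) :
    coeffCLM X p α f = torusCoeff f α := rfl

/-- The Hardy space as a closed subspace of `L_p`. -/
def hardySubmodule (X : Type*) [NormedAddCommGroup X] [NormedSpace ℂ X] (p : ℝ≥0∞)
    [Fact (1 ≤ p)] : Submodule ℂ (Lp X p polytorusMeasure) :=
  ⨅ (α : ℕ →₀ ℤ) (_ : ∃ j, α j < 0), (coeffCLM X p α).ker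

lemma mem_hardySubmodule (p : ℝ≥0∞) [Fact (1 ≤ p)] (f : Lp X p polytorusMeasure) :
    f ∈ hardySubmodule X p ↔ ∀ α : ℕ →₀ ℤ, (∃ j, α j < 0) → coeffCLM X p α f = 0 := by
  simp [hardySubmodule, Submodule.mem_iInf]

lemma isClosed_hardySubmodule (p : ℝ≥0∞) [Fact (1 ≤ p)] :
    IsClosed (hardySubmodule X p : Set (Lp X p polytorusMeasure)) := by
  have : (hardySubmodule X p : Set (Lp X p polytorusMeasure)) =
      ⋂ (α : ℕ →₀ ℤ) (_ : ∃ j, α j < 0), {f | coeffCLM X p α f = 0} := by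
    ext f
    simp [mem_hardySubmodule]
  rw [this]
  exact isClosed_iInter fun α => isClosed_iInter fun _ =>
    isClosed_eq (coeffCLM X p α).continuous continuous_const

/-- The uniform boundedness principle for seminorms. -/
lemma exists_seminorm_bound {ι E : Type*} [NormedAddCommGroup E] [NormedSpace ℂ E]
    [CompleteSpace E] (q : ι → Seminorm ℂ E) (hq : ∀ i, Continuous (q i))
    (hb : ∀ f, BddAbove (Set.range fun i => q i f)) :
    ∃ C : ℝ, 0 < C ∧ ∀ i f, q i f ≤ C * ‖f‖ := by
  have hbdd : BddAbove (Set.range q) := Seminorm.bddAbove_range_iff.2 hb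
  have h := Seminorm.continuous_iSup q hq hbdd
  rw [← Seminorm.coe_iSup_eq hbdd] at h
  obtain ⟨C, hC0, hC⟩ := Seminorm.bound_of_continuous_normedSpace _ h
  exact ⟨C, hC0, fun i f => (Seminorm.le_def.1 (le_ciSup hbdd i) _).trans (hC _)⟩

/-- The partial sums are continuous seminorms on the Banach space `H_p`, pointwise bounded by
hypothesis, hence uniformly bounded. Testing on linear polynomials and comparing `L_p` with `L_2`
gives the claim. -/
lemma exists_sum_mul_norm_le [CompleteSpace X] {p : ℝ≥0∞} (hp1 : 1 ≤ p) (hp : p ≠ ⊤) {z : ℕ → ℝ}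
    (hz0 : ∀ k, 0 ≤ z k)
    (hz : ∀ f ∈ hardySpace X p,
      Summable fun k : ℕ => z k * ‖powerCoeff f (Finsupp.single k 1)‖) :
    ∃ C : ℝ, 0 < C ∧ ∀ (N : ℕ) (x : Fin N → X), ∑ k : Fin N, z k * ‖x k‖ ≤ C * linNorm x := by
  have : Fact (1 ≤ p) := ⟨hp1⟩
  have : CompleteSpace (hardySubmodule X p) :=
    (isClosed_hardySubmodule p).completeSpace_coe
  let e : ℕ → (ℕ →₀ ℤ) := fun k => Finsupp.single k 1
  let q : ℕ → Seminorm ℂ (hardySubmodule X p) := fun N =>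
    ∑ k ∈ Finset.range N, (z k).toNNReal •
      (normSeminorm ℂ X).comp ((coeffCLM X p (e k)).toLinearMap ∘ₗ (hardySubmodule X p).subtype)
  have hq : ∀ N f, q N f = ∑ k ∈ Finset.range N, z k * ‖torusCoeff (f : Lp X p polytorusMeasure) (e k)‖ := by
    intro N f
    induction N with
    | zero => simp [q]
    | succ N ih =>
      simp only [q] at ih
      simp only [q, Finset.sum_range_succ, add_apply, ih]
      congr 1
      simp only [smul_apply, NNReal.smul_def, Real.coe_toNNReal _ (hz0 _)]
      rfl
  have hcont : ∀ N, Continuous (q N) := by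
    intro N
    have : ⇑(q N) = fun f : hardySubmodule X p =>
        ∑ k ∈ Finset.range N, z k * ‖coeffCLM X p (e k) f‖ := funext (hq N)
    rw [this]
    fun_prop
  have hmem : ∀ f : hardySubmodule X p, ((f : Lp X p polytorusMeasure) : (ℕ → Circle) → X) ∈ hardySpace X p :=
    fun f => ⟨Lp.memLp _, fun α hα => (mem_hardySubmodule p _).1 f.2 α hα⟩
  obtain ⟨C, hC0, hC⟩ := exists_seminorm_bound q hcont fun f => by
    have := hz _ (hmem f)
    refine ⟨∑' k, z k * ‖powerCoeff (f : Lp X p polytorusMeasure) (Finsupp.single k 1)‖, ?_⟩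
    rintro _ ⟨N, rfl⟩
    dsimp only
    rw [hq]
    simp only [e, ← powerCoeff_single]
    exact this.sum_le_tsum _ fun k _ => mul_nonneg (hz0 k) (norm_nonneg _)
  obtain ⟨D, hD0, hD⟩ := exists_eLpNorm_linPoly_le X hp
  refine ⟨C * D, by positivity, fun N x => ?_⟩
  let F : Lp X p polytorusMeasure := (memLp_linFun x p).toLp
  have hF : F =ᵐ[polytorusMeasure] linFun x := MemLp.coeFn_toLp _
  have hFm : F ∈ hardySubmodule X p := by
    rw [mem_hardySubmodule]
    intro α hα
    rw [coeffCLM_apply, torusCoeff_congr_ae hF]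
    exact (linFun_mem_hardySpace x p).2 α hα
  have h1 : q N ⟨F, hFm⟩ ≤ C * ‖F‖ := hC N _
  rw [hq, Finset.sum_range] at h1
  simp only [torusCoeff_congr_ae hF, e, torusCoeff_linFun_single] at h1
  refine h1.trans ?_
  rw [mul_assoc]
  gcongr
  rw [Lp.norm_toLp, eLpNorm_linFun]
  exact hD N x

end

/-! ### From monomial convergence to cotype. -/

section

variable {X : Type*} [NormedAddCommGroup X] [NormedSpace ℂ X]

/-- The cotype inequality, without the restriction `2 ≤ q`. -/
def CotypeIneq (X : Type*) [NormedAddCommGroup X] [NormedSpace ℂ X] (q : ℝ) : Prop :=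
  ∃ C : ℝ, 0 ≤ C ∧ ∀ (N : ℕ) (x : Fin N → X), (∑ k, ‖x k‖ ^ q) ^ (1 / q) ≤ C * linNorm x

lemma integral_norm_sum_sq (N : ℕ) :
    ∫ w, ‖∑ k : Fin N, ((w k : Circle) : ℂ)‖ ^ 2 ∂polytorusMeasure = N := by
  let e : Fin N → (ℕ →₀ ℤ) := fun k => Finsupp.single (k : ℕ) 1
  have he : ∀ j k, e j + -e k = 0 ↔ j = k := by
    intro j k
    rw [← sub_eq_add_neg, sub_eq_zero]
    exact ⟨fun h => Fin.ext (Finsupp.single_left_injective one_ne_zero h), fun h => h ▸ rfl⟩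
  have hinv : ∀ (k : Fin N) (w : ℕ → Circle), torusMonomial (-e k) w
      = (starRingEnd ℂ) ((w k : Circle) : ℂ) := by
    intro k w
    have h := torusMonomial_add (e k) (-e k) w
    rw [add_neg_cancel, torusMonomial_single] at h
    have h1 : torusMonomial 0 w = 1 := by simp [torusMonomial]
    rw [h1] at h
    rw [← Circle.coe_inv_eq_conj, Circle.coe_inv]
    exact eq_inv_of_mul_eq_one_right h.symm
  have hpt : ∀ w : ℕ → Circle, ((‖∑ k : Fin N, ((w k : Circle) : ℂ)‖ ^ 2 : ℝ) : ℂ)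
      = ∑ j, ∑ k, torusMonomial (e j + -e k) w := by
    intro w
    simp only [torusMonomial_add, hinv]
    rw [Complex.ofReal_pow, ← Complex.mul_conj', map_sum, Finset.sum_mul_sum]
    simp [e, torusMonomial_single]
  have hint : ∀ β, Integrable (torusMonomial β) polytorusMeasure := fun β =>
    Integrable.of_bound (continuous_torusMonomial β).aestronglyMeasurable 1
      (ae_of_all _ fun w => (norm_torusMonomial β w).le)
  have h : ∫ w, ((‖∑ k : Fin N, ((w k : Circle) : ℂ)‖ ^ 2 : ℝ) : ℂ) ∂polytorusMeasure
      = (N : ℝ) := by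
    simp only [hpt]
    rw [integral_finsetSum _ fun j _ => integrable_finsetSum _ fun k _ => hint _]
    simp only [integral_finsetSum _ fun k _ => hint _, integral_torusMonomial, he]
    simp
  rw [integral_complex_ofReal] at h
  exact_mod_cast h

lemma linNorm_const (N : ℕ) (v : X) : linNorm (fun _ : Fin N => v) = √N * ‖v‖ := by
  rw [← sq_eq_sq₀ (linNorm_nonneg _) (by positivity), linNorm_sq, mul_pow,
    Real.sq_sqrt (by positivity), ← integral_norm_sum_sq N]
  have h := integral_map_of_stronglyMeasurable
    (μ := polytorusMeasure) (measurePreserving_polytorus_torus N).measurable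
    (f := fun z => ‖linPoly (fun _ : Fin N => v) z‖ ^ 2)
    (Continuous.stronglyMeasurable ((continuous_linPoly _).norm.pow 2))
  rw [(measurePreserving_polytorus_torus N).map_eq] at h
  rw [h, ← integral_mul_const]
  congr 1 with w
  rw [linPoly, ← Finset.sum_smul, norm_smul, mul_pow]

/-- For `N` copies of one nonzero vector the inequality reads `N ^ (1/q) ≤ C √N`, which fails for
large `N` if `q < 2`. -/
lemma CotypeIneq.two_le [Nontrivial X] {q : ℝ} (hq : 0 < q) (h : CotypeIneq X q) : 2 ≤ q := by
  obtain ⟨C, hC0, hC⟩ := h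
  obtain ⟨v, hv⟩ := exists_ne (0 : X)
  have hv' : 0 < ‖v‖ := norm_pos_iff.2 hv
  by_contra! hlt
  have hb : ∀ N : ℕ, 0 < N → (N : ℝ) ^ (1 / q - 1 / 2) ≤ C := by
    intro N hN
    have hN' : (0 : ℝ) < N := by exact_mod_cast hN
    have h1 := hC N fun _ => v
    rw [linNorm_const] at h1
    simp only [Finset.sum_const, Finset.card_univ, Fintype.card_fin, nsmul_eq_mul] at h1
    rw [Real.mul_rpow hN'.le (by positivity), ← Real.rpow_mul hv'.le, mul_one_div_cancel hq.ne',
      Real.rpow_one, ← mul_assoc] at h1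
    have h2 := le_of_mul_le_mul_right h1 hv'
    rw [Real.rpow_sub hN', ← Real.sqrt_eq_rpow, div_le_iff₀ (by positivity)]
    exact h2
  have hpos : 0 < 1 / q - 1 / 2 := by
    rw [sub_pos]
    exact one_div_lt_one_div_of_lt hq hlt
  have ht := (tendsto_rpow_atTop hpos).comp tendsto_natCast_atTop_atTop
  obtain ⟨N, hN1, hN⟩ := ((ht.eventually_gt_atTop C).and (Filter.eventually_gt_atTop 0)).exists
  exact absurd (hb N hN) (not_le.2 hN1)

lemma CotypeIneq.hasCotype [Nontrivial X] {q : ℝ} (hq : 0 < q) (h : CotypeIneq X q) :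
    HasCotype X q := ⟨h.two_le hq, h⟩

lemma LrSubsetMon.mono {p r s : ℝ≥0∞} (hrs : r ≤ s) (h : LrSubsetMon X p s) :
    LrSubsetMon X p r := fun _ hz => h ⟨hz.1.of_exponent_ge hrs, hz.2⟩

lemma summable_of_mem_mon {p : ℝ≥0∞} {z : ℕ → ℂ} (hz : z ∈ mon X p) {f : (ℕ → Circle) → X}
    (hf : f ∈ hardySpace X p) :
    Summable fun k : ℕ => ‖z k‖ * ‖powerCoeff f (Finsupp.single k 1)‖ := by
  have h := (hz.2 f hf).comp_injective (Finsupp.single_left_injective (M := ℕ) one_ne_zero)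
  refine h.congr fun k => ?_
  simp [norm_smul]

/-- The constant of `exists_sum_mul_norm_le` depends on `z`. Uniform boundedness on `ℓ_r`, over all
linear polynomials of norm at most 1, makes it a multiple of `‖z‖_r`; the extremal `z` of Hölder's
inequality then yields the `ℓ_{r'}` norm of the family. -/
lemma LrSubsetMon.cotypeIneq [CompleteSpace X] {p : ℝ≥0∞} (hp1 : 1 ≤ p) (hp : p ≠ ⊤) {r : ℝ}
    (hr : 1 < r) (h : LrSubsetMon X p (ENNReal.ofReal r)) : CotypeIneq X r.conjExponent := by
  have hr0 : 0 < r := by linarith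
  have : Fact (1 ≤ ENNReal.ofReal r) := ⟨by rw [← ENNReal.ofReal_one]; gcongr⟩
  have htr : (ENNReal.ofReal r).toReal = r := ENNReal.toReal_ofReal hr0.le
  have hne : ENNReal.ofReal r ≠ 0 := by simpa using hr0
  let E := lp (fun _ : ℕ => ℂ) (ENNReal.ofReal r)
  let I := Σ N : ℕ, {x : Fin N → X // linNorm x ≤ 1}
  let ev : ℕ → E →L[ℂ] ℂ := fun k => lp.evalCLM ℂ (fun _ : ℕ => ℂ) (ENNReal.ofReal r) k
  let S : I → Seminorm ℂ E := fun i =>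
    ∑ k : Fin i.1, (normSeminorm ℂ ℂ).comp ((‖i.2.1 k‖ : ℂ) • ev k).toLinearMap
  have hS : ∀ i z, S i z = ∑ k : Fin i.1, ‖z k‖ * ‖i.2.1 k‖ := by
    intro i z
    have hgen : ∀ (s : Finset (Fin i.1)), (∑ k ∈ s, (normSeminorm ℂ ℂ).comp
        ((‖i.2.1 k‖ : ℂ) • ev k).toLinearMap) z = ∑ k ∈ s, ‖z k‖ * ‖i.2.1 k‖ := by
      intro s
      induction s using Finset.cons_induction with
      | empty => simp
      | cons a s ha ih =>
        rw [Finset.sum_cons, Finset.sum_cons, add_apply, ih]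
        congr 1
        have : (normSeminorm ℂ ℂ).comp ((‖i.2.1 a‖ : ℂ) • ev a).toLinearMap z
          = ‖(‖i.2.1 a‖ : ℂ) * z a‖ := rfl
        rw [this, norm_mul, Complex.norm_real, norm_norm, mul_comm]
    exact hgen _
  have hcont : ∀ i, Continuous (S i) := by
    intro i
    have h1 : ⇑(S i) = fun z : E => ∑ k : Fin i.1, ‖ev k z‖ * ‖i.2.1 k‖ := funext (hS i)
    rw [h1]
    fun_prop
  obtain ⟨C, hC0, hC⟩ := exists_seminorm_bound S hcont fun z => by
    -- Scaling moves an arbitrary `z` in `ℓ_r` into the open unit ball of `c_0`, where the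
    -- hypothesis applies.
    set c : ℝ := (‖z‖ + 1)⁻¹ with hc
    have hc0 : 0 < c := by positivity
    have hmem : (fun k => (c : ℂ) * z k) ∈ mon X p := by
      refine h ⟨(lp.memℓp z).const_smul (c : ℂ), ?_, fun n => ?_⟩
      · have h1 : Summable fun k => ‖z k‖ ^ r := by
          have := (lp.memℓp z).summable (by rw [htr]; exact hr0)
          rwa [htr] at this
        have h2 := h1.tendsto_atTop_zero.rpow_const (p := r⁻¹) (Or.inr (by positivity))
        have h3 : Filter.Tendsto (fun k => z k) Filter.atTop (𝓝 0) := by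
          rw [tendsto_zero_iff_norm_tendsto_zero]
          rw [Real.zero_rpow (by positivity)] at h2
          refine h2.congr fun k => ?_
          rw [Real.rpow_rpow_inv (norm_nonneg _) hr0.ne']
        simpa using h3.const_mul (c : ℂ)
      · rw [norm_mul, Complex.norm_real, Real.norm_of_nonneg hc0.le, hc,
          inv_mul_lt_iff₀ (by positivity)]
        have := lp.norm_apply_le_norm hne z n
        linarith
    obtain ⟨D, hD0, hD⟩ := exists_sum_mul_norm_le hp1 hp (z := fun k => ‖(c : ℂ) * z k‖)
      (fun k => norm_nonneg _) fun f hf => summable_of_mem_mon hmem hf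
    refine ⟨c⁻¹ * D, ?_⟩
    rintro _ ⟨i, rfl⟩
    dsimp only
    rw [hS, ← div_eq_inv_mul, le_div_iff₀ hc0]
    have h1 := (hD i.1 i.2.1).trans (mul_le_of_le_one_right hD0.le i.2.2)
    refine le_trans (le_of_eq ?_) h1
    rw [Finset.sum_mul]
    refine Finset.sum_congr rfl fun k _ => ?_
    rw [norm_mul, Complex.norm_real, Real.norm_of_nonneg hc0.le]
    ring
  have hconj : r.HolderConjugate r.conjExponent := Real.HolderConjugate.conjExponent hr
  set q := r.conjExponent
  have hq0 : 0 < q := hconj.symm.pos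
  refine ⟨C, hC0.le, fun N x => ?_⟩
  set T := ∑ k, ‖x k‖ ^ q with hT
  have hT0 : 0 ≤ T := Finset.sum_nonneg fun _ _ => by positivity
  have hL0 := linNorm_nonneg x
  -- Equality case of Hölder: since `(q - 1) r = q`, both `∑ |z_k| ^ r` and `∑ |z_k| ‖x_k‖` equal
  -- `T`.
  let zf : ℕ → ℂ := fun k => if h : k < N then ((‖x ⟨k, h⟩‖ ^ (q - 1) : ℝ) : ℂ) else 0
  have hzf : ∀ k : Fin N, zf k = ((‖x k‖ ^ (q - 1) : ℝ) : ℂ) := fun k => by simp [zf]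
  have hzf0 : ∀ k ∉ Finset.range N, ‖zf k‖ ^ r = 0 := by
    intro k hk
    have : ¬ k < N := by simpa using hk
    simp [zf, this, hr0.ne']
  have hqr : (q - 1) * r = q := by
    have := hconj.symm.sub_one_mul_conj
    exact this
  have hsum : ∑' k, ‖zf k‖ ^ r = T := by
    rw [tsum_eq_sum hzf0, Finset.sum_range]
    refine Finset.sum_congr rfl fun k _ => ?_
    rw [hzf, Complex.norm_real, Real.norm_of_nonneg (by positivity),
      ← Real.rpow_mul (norm_nonneg _), hqr]
  have hzm : Memℓp zf (ENNReal.ofReal r) := by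
    refine memℓp_gen ?_
    rw [htr]
    exact summable_of_ne_finset_zero hzf0
  let z : E := ⟨zf, hzm⟩
  have hzn : ‖z‖ = T ^ (1 / r) := by
    rw [lp.norm_eq_tsum_rpow (by rw [htr]; exact hr0), htr, ← hsum]
  -- The `ε` allows normalization without knowing that `linNorm x` is nonzero.
  have hkey : ∀ ε : ℝ, 0 < ε → T ≤ C * T ^ (1 / r) * (linNorm x + ε) := by
    intro ε hε
    set t : ℝ := (linNorm x + ε)⁻¹ with ht
    have ht0 : 0 < t := by positivity
    have hy : linNorm ((t : ℂ) • x) ≤ 1 := by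
      rw [linNorm_smul, Complex.norm_real, Real.norm_of_nonneg ht0.le, ht,
        inv_mul_le_iff₀ (by positivity)]
      linarith
    have h1 := hC ⟨N, ⟨(t : ℂ) • x, hy⟩⟩ z
    rw [hS, hzn] at h1
    have h2 : ∑ k : Fin N, ‖z k‖ * ‖((t : ℂ) • x) k‖ = t * T := by
      rw [hT, Finset.mul_sum]
      refine Finset.sum_congr rfl fun k _ => ?_
      have : z k = zf k := rfl
      rw [this, hzf, Pi.smul_apply, norm_smul, Complex.norm_real, Complex.norm_real,
        Real.norm_of_nonneg ht0.le, Real.norm_of_nonneg (by positivity)]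
      rcases (norm_nonneg (x k)).eq_or_lt with h0 | h0
      · rw [← h0, Real.zero_rpow hq0.ne']; ring
      · rw [Real.rpow_sub_one h0.ne']; field_simp
    rw [h2, ht, inv_mul_le_iff₀ (by positivity)] at h1
    linarith
  have hkey2 : T ≤ C * T ^ (1 / r) * linNorm x := by
    have hcon : Filter.Tendsto (fun ε : ℝ => C * T ^ (1 / r) * (linNorm x + ε)) (𝓝[>] 0)
        (𝓝 (C * T ^ (1 / r) * (linNorm x + 0))) :=
      Filter.Tendsto.mono_left (Continuous.tendsto (by fun_prop) 0) nhdsWithin_le_nhds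
    rw [add_zero] at hcon
    exact ge_of_tendsto hcon (by filter_upwards [self_mem_nhdsWithin] with ε hε using hkey ε hε)
  rcases hT0.eq_or_lt with h0 | h0
  · rw [← h0, Real.zero_rpow (by positivity)]
    positivity
  · have h1 : T = T ^ (1 / r) * T ^ (1 / q) := by
      rw [← Real.rpow_add h0, one_div, one_div, hconj.inv_add_inv_eq_one, Real.rpow_one]
    have h2 : T ^ (1 / r) * T ^ (1 / q) ≤ T ^ (1 / r) * (C * linNorm x) := by
      rw [← h1]; linarith
    exact le_of_mul_le_mul_left h2 (by positivity)

/-- If `ℓ_r ∩ B_{c_0}` consists of points of monomial convergence, then `X` has cotype the conjugate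
exponent of `r`. -/
lemma LrSubsetMon.hasCotype [CompleteSpace X] [Nontrivial X] {p : ℝ≥0∞} (hp1 : 1 ≤ p)
    (hp : p ≠ ⊤) {r : ℝ≥0∞} (hr : 1 < r) (h : LrSubsetMon X p r) :
    HasCotype X (ENNReal.conjExponent r).toReal := by
  rcases eq_or_ne r ⊤ with rfl | hrt
  -- The case `r = ∞` cannot occur: it would give the inequality with exponent `3/2 < 2`, the
  -- conjugate of 3.
  · have h3 : LrSubsetMon X p (ENNReal.ofReal 3) := h.mono le_top
    have := (h3.cotypeIneq hp1 hp (by norm_num)).two_le (by norm_num [Real.conjExponent])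
    norm_num [Real.conjExponent] at this
  · have hr1 : 1 < r.toReal := by
      rw [← ENNReal.toReal_one]
      exact (ENNReal.toReal_lt_toReal (by simp) hrt).2 hr
    have hconj := Real.HolderConjugate.conjExponent hr1
    have e : (ENNReal.conjExponent r).toReal = r.toReal.conjExponent := by
      have hE := hconj.ennrealOfReal
      rw [ENNReal.ofReal_toReal hrt] at hE
      rw [hE.conjExponent_eq, ENNReal.toReal_ofReal hconj.symm.nonneg]
    rw [e]
    refine CotypeIneq.hasCotype hconj.symm.pos (LrSubsetMon.cotypeIneq hp1 hp hr1 ?_)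
    rwa [ENNReal.ofReal_toReal hrt]

end

/-! ### Primes, Dirichlet series and the abscissa bounds. -/

section

/-- A Chebyshev type bound for the `k`-th prime. -/
lemma exists_prime_rpow_le {s : ℝ} (hs0 : 0 < s) (hs1 : s < 1) :
    ∃ C : ℝ, 0 < C ∧ ∀ k : ℕ, ((prime k : ℕ) : ℝ) ^ s ≤ C * (k + 1) := by
  have hpi : ∀ k, ((prime k : ℕ).primeCounting : ℝ) = k + 1 := by
    intro k
    have h : (prime k : ℕ).primeCounting = k + 1 := by
      rw [Nat.primeCounting, Nat.primeCounting', Nat.count_succ]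
      have h1 : Nat.count Nat.Prime (prime k : ℕ) = k := Nat.primeCounting'_nth_eq k
      have h2 : Nat.Prime (prime k : ℕ) := Nat.prime_nth_prime k
      rw [h1, if_pos h2]
    rw [h]; push_cast; ring
  have hev : ∀ᶠ x : ℝ in Filter.atTop, x ^ s * Real.log x ≤ x * Real.log 2 - Real.log (x + 1) := by
    have hlog2 : 0 < Real.log 2 := Real.log_pos one_lt_two
    have h1 := (isLittleO_log_rpow_atTop (r := 1 - s) (by linarith)).bound
      (c := Real.log 2 / 2) (by positivity)
    have h2 := Real.isLittleO_log_id_atTop.bound (c := Real.log 2 / 4) (by positivity)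
    have h3 := (Filter.tendsto_atTop_add_const_right Filter.atTop (1 : ℝ)
      Filter.tendsto_id).eventually h2
    filter_upwards [h1, h3, Filter.eventually_ge_atTop 1] with x hx1 hx3 hx
    have hx0 : 0 < x := by linarith
    simp only [id, Real.norm_eq_abs] at hx1 hx3
    rw [abs_of_nonneg (Real.log_nonneg hx), abs_of_nonneg (by positivity)] at hx1
    rw [abs_of_nonneg (Real.log_nonneg (by linarith)), abs_of_nonneg (by linarith)] at hx3
    have h4 : x ^ s * Real.log x ≤ x ^ s * (Real.log 2 / 2 * x ^ (1 - s)) := by gcongr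
    have h5 : x ^ s * x ^ (1 - s) = x := by
      rw [← Real.rpow_add hx0]; simp
    have h6 : x ^ s * (Real.log 2 / 2 * x ^ (1 - s)) = Real.log 2 / 2 * x := by
      linear_combination (Real.log 2 / 2) * h5
    nlinarith
  obtain ⟨x₀, hx₀⟩ := Filter.eventually_atTop.1 hev
  -- Beyond `x₀`, Chebyshev's lower bound on the prime count `k + 1` gives constant 1; primes up to
  -- `x₀` are covered by `|x₀| ^ s`.
  refine ⟨max 1 (|x₀| ^ s), by positivity, fun k => ?_⟩
  set n : ℕ := (prime k : ℕ)
  have hn1 : 1 < n := (Nat.prime_nth_prime k).one_lt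
  have hlog : 0 < Real.log n := Real.log_pos (by exact_mod_cast hn1)
  have hk : (0 : ℝ) ≤ k := by positivity
  rcases le_total x₀ n with h | h
  · have h1 := hx₀ _ h
    have h2 := Chebyshev.pi_ge n
    rw [hpi k] at h2
    rw [← le_div_iff₀ hlog] at h1
    refine (h1.trans h2).trans ?_
    exact le_mul_of_one_le_left (by positivity) (le_max_left _ _)
  · have h1 : (n : ℝ) ^ s ≤ |x₀| ^ s := by
      gcongr
      exact h.trans (le_abs_self _)
    refine (h1.trans (le_max_right 1 _)).trans ?_
    exact le_mul_of_one_le_right (by positivity) (by linarith)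

lemma exists_le_prime_rpow_neg {σ τ : ℝ} (hσ : 0 < σ) (hτ : σ < τ) :
    ∃ c : ℝ, 0 < c ∧ ∀ k : ℕ, c * ((k : ℝ) + 1) ^ (-τ) ≤ ((prime k : ℕ) : ℝ) ^ (-σ) := by
  have hτ0 : 0 < τ := hσ.trans hτ
  obtain ⟨C, hC0, hC⟩ := exists_prime_rpow_le (s := σ / τ) (by positivity)
    ((div_lt_one hτ0).2 hτ)
  refine ⟨C ^ (-τ), by positivity, fun k => ?_⟩
  have hp : (0 : ℝ) < (prime k : ℕ) := by exact_mod_cast (prime k).pos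
  have h1 := Real.rpow_le_rpow_of_nonpos (by positivity) (hC k) (neg_nonpos.2 hτ0.le)
  rw [Real.mul_rpow hC0.le (by positivity), ← Real.rpow_mul hp.le] at h1
  refine h1.trans_eq ?_
  congr 1
  field_simp

variable {X : Type*} [NormedAddCommGroup X] [NormedSpace ℂ X]

/-- For decreasing norms, the first `n + 1` terms of the weighted sum are each at least `(n + 1) ^
(-τ) ‖x_n‖`, so `‖x_n‖ ≤ B (n + 1) ^ (-(1 - τ)) linNorm x`. This is `q`-summable precisely because
`q (1 - τ) > 1`. -/
lemma cotypeIneq_of_sum_rpow_le {τ B q : ℝ} (hτ0 : 0 < τ) (hτ1 : τ < 1)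
    (hB : 0 ≤ B)
    (h : ∀ (N : ℕ) (x : Fin N → X),
      ∑ k : Fin N, ((k : ℝ) + 1) ^ (-τ) * ‖x k‖ ≤ B * linNorm x)
    (hq : 1 < q * (1 - τ)) : CotypeIneq X q := by
  have hq0 : 0 < q := by
    by_contra! hn
    nlinarith
  have hsum : Summable fun n : ℕ => ((n : ℝ) + 1) ^ (-(q * (1 - τ))) := by
    have h1 : Summable fun n : ℕ => (n : ℝ) ^ (-(q * (1 - τ))) :=
      Real.summable_nat_rpow.2 (by linarith)
    simpa using (summable_nat_add_iff 1).2 h1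
  set Z := ∑' n : ℕ, ((n : ℝ) + 1) ^ (-(q * (1 - τ)))
  have hZ0 : 0 ≤ Z := tsum_nonneg fun n => by positivity
  refine ⟨B * Z ^ (1 / q), by positivity, ?_⟩
  have hanti : ∀ (N : ℕ) (x : Fin N → X), Antitone (fun k => ‖x k‖) →
      (∑ k, ‖x k‖ ^ q) ^ (1 / q) ≤ B * Z ^ (1 / q) * linNorm x := by
    intro N x hx
    have hL0 := linNorm_nonneg x
    have hterm : ∀ n : Fin N, ‖x n‖ ≤ B * linNorm x * ((n : ℝ) + 1) ^ (-(1 - τ)) := by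
      intro n
      have hn0 : (0 : ℝ) < (n : ℝ) + 1 := by positivity
      have h1 : ∑ k ∈ Finset.Iic n, ((n : ℝ) + 1) ^ (-τ) * ‖x n‖
          ≤ ∑ k : Fin N, ((k : ℝ) + 1) ^ (-τ) * ‖x k‖ := by
        refine le_trans (Finset.sum_le_sum fun k hk => ?_)
          (Finset.sum_le_sum_of_subset_of_nonneg (Finset.subset_univ (Finset.Iic n))
            fun i _ _ => by positivity)
        have hk' : k ≤ n := Finset.mem_Iic.1 hk
        have hkn : (k : ℝ) ≤ n := by exact_mod_cast hk'
        refine mul_le_mul ?_ (hx hk') (norm_nonneg _) (by positivity)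
        exact Real.rpow_le_rpow_of_nonpos (by positivity) (by linarith) (by linarith)
      rw [Finset.sum_const, Fin.card_Iic, nsmul_eq_mul] at h1
      have h2 := h1.trans (h N x)
      push_cast at h2
      have e1 : ((n : ℝ) + 1) ^ (-(1 - τ)) * (((n : ℝ) + 1) * ((n : ℝ) + 1) ^ (-τ)) = 1 := by
        nth_rewrite 2 [← Real.rpow_one ((n : ℝ) + 1)]
        rw [← Real.rpow_add hn0, ← Real.rpow_add hn0, show -(1 - τ) + (1 + -τ) = 0 by ring,
          Real.rpow_zero]
      have h3 := mul_le_mul_of_nonneg_left h2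
        (by positivity : 0 ≤ ((n : ℝ) + 1) ^ (-(1 - τ)))
      calc ‖x n‖ = (((n : ℝ) + 1) ^ (-(1 - τ)) * (((n : ℝ) + 1) * ((n : ℝ) + 1) ^ (-τ))) * ‖x n‖ := by
            rw [e1, one_mul]
        _ = ((n : ℝ) + 1) ^ (-(1 - τ)) * (((n : ℝ) + 1) * (((n : ℝ) + 1) ^ (-τ) * ‖x n‖)) := by
            ring
        _ ≤ _ := h3.trans_eq (by ring)
    have hS : ∑ k, ‖x k‖ ^ q ≤ (B * linNorm x) ^ q * Z := by
      calc ∑ k, ‖x k‖ ^ q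
          ≤ ∑ k : Fin N, (B * linNorm x) ^ q * ((k : ℝ) + 1) ^ (-(q * (1 - τ))) := by
            refine Finset.sum_le_sum fun k _ => ?_
            refine (Real.rpow_le_rpow (norm_nonneg _) (hterm k) hq0.le).trans_eq ?_
            rw [Real.mul_rpow (by positivity) (by positivity), ← Real.rpow_mul (by positivity)]
            congr 2
            ring
        _ = (B * linNorm x) ^ q * ∑ k ∈ Finset.range N, ((k : ℝ) + 1) ^ (-(q * (1 - τ))) := by
            rw [← Finset.mul_sum, Finset.sum_range]
        _ ≤ _ := by
            gcongr
            exact hsum.sum_le_tsum _ fun _ _ => by positivity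
    refine (Real.rpow_le_rpow (Finset.sum_nonneg fun _ _ => by positivity) hS
      (by positivity)).trans_eq ?_
    rw [Real.mul_rpow (by positivity) hZ0, one_div, Real.rpow_rpow_inv (by positivity) hq0.ne']
    ring
  intro N x
  -- Sorting by decreasing norm is harmless: both sides are invariant under permutations.
  let π := Tuple.sort fun k => -‖x k‖
  have h1 := hanti N (x ∘ π) fun i j hij => by
    have := Tuple.monotone_sort (fun k => -‖x k‖) hij
    simpa [π] using this
  rw [linNorm_comp_perm] at h1
  simp only [Function.comp_apply] at h1
  rwa [Equiv.sum_comp π (fun k => ‖x k‖ ^ q)] at h1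

lemma primePow_single (k : ℕ) : primePow (Finsupp.single k 1) = prime k := by
  simp [primePow]

lemma primePow_injective : Function.Injective primePow := by
  have h : ∀ (α : ℕ →₀ ℕ) (j : ℕ),
      (primePow α : ℕ).factorization (Nat.nth Nat.Prime j) = α j := by
    intro α j
    have hinj : Function.Injective (Nat.nth Nat.Prime) :=
      Nat.nth_injective Nat.infinite_setOfPred_prime
    let β := α.embDomain ⟨Nat.nth Nat.Prime, hinj⟩
    have h1 : (primePow α : ℕ) = β.prod (· ^ ·) := by
      simp only [β, Finsupp.prod, Finsupp.support_embDomain, Finset.prod_map, primePow]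
      change PNat.coeMonoidHom _ = _
      rw [map_prod]
      refine Finset.prod_congr rfl fun i _ => ?_
      rw [Finsupp.embDomain_apply_self, map_pow]
      rfl
    have h2 : ∀ p ∈ β.support, Nat.Prime p := by
      intro p hp
      simp only [β, Finsupp.support_embDomain, Finset.mem_map] at hp
      obtain ⟨i, _, rfl⟩ := hp
      exact Nat.prime_nth_prime i
    rw [h1, Nat.prod_pow_factorization_eq_self h2]
    exact Finsupp.embDomain_apply_self ⟨_, hinj⟩ α j
  intro α β hab
  ext j
  rw [← h α, ← h β, hab]

lemma sigmaHardy_nonpos {p : ℝ≥0∞} {a : ℕ+ → X} (ha : a ∈ dirichletHardy X p) :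
    sigmaHardy p a ≤ 0 := by
  refine iInf₂_le (0 : ℝ) ?_
  simpa using ha

/-- For a series in `𝓗_p(X)` the choice `σ = 0` is admissible, so the subtracted abscissa is at most
0. -/
lemma iSup_sigmaAbs_le_bohrStrip (p : ℝ≥0∞) :
    ⨆ a ∈ dirichletHardy X p, sigmaAbs a ≤ bohrStrip X p := by
  refine iSup₂_le fun a ha => le_iSup_of_le a ?_
  calc sigmaAbs a = sigmaAbs a - 0 := (sub_zero _).symm
    _ ≤ _ := EReal.sub_le_sub le_rfl (sigmaHardy_nonpos ha)

lemma summable_prime_of_sigmaAbs_lt {p : ℝ≥0∞} {σ : ℝ}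
    (hσ : ⨆ a ∈ dirichletHardy X p, sigmaAbs a < (σ : EReal)) {f : (ℕ → Circle) → X}
    (hf : f ∈ hardySpace X p) :
    Summable fun k : ℕ => ((prime k : ℕ) : ℝ) ^ (-σ) * ‖powerCoeff f (Finsupp.single k 1)‖ := by
  -- The Dirichlet series attached to `f`; injectivity of `primePow` makes its coefficients well
  -- defined.
  let a : ℕ+ → X := Function.extend primePow (powerCoeff f) 0
  have ha : ∀ α, a (primePow α) = powerCoeff f α := primePow_injective.extend_apply _ _
  have h1 : sigmaAbs a < σ := lt_of_le_of_lt (le_iSup₂_of_le a ⟨f, hf, ha⟩ le_rfl) hσ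
  obtain ⟨r, hr, hrσ⟩ := by simpa only [sigmaAbs, iInf_lt_iff] using h1
  have h2 := hr (σ : ℂ) (by simpa using hrσ)
  have h3 := h2.comp_injective (primePow_injective.comp
    (Finsupp.single_left_injective (M := ℕ) one_ne_zero))
  refine h3.congr fun k => ?_
  simp only [Function.comp_apply, norm_smul, ha]
  rw [primePow_single, Complex.norm_natCast_cpow_of_pos (prime k).pos]
  simp

lemma two_le_cot (X : Type*) [NormedAddCommGroup X] [NormedSpace ℂ X] : 2 ≤ cot X := by
  refine le_iInf₂ fun q hq => ?_
  rw [← ENNReal.ofReal_ofNat]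
  exact ENNReal.ofReal_le_ofReal hq.1

lemma one_sub_le_of_ofReal_le {t : ℝ} (ht : 0 ≤ t) {c : ℝ≥0∞} :
    (ENNReal.ofReal t ≤ c → (1 : EReal) - (c : EReal) ≤ ((1 - t : ℝ) : EReal)) ∧
    (c ≤ ENNReal.ofReal t → ((1 - t : ℝ) : EReal) ≤ (1 : EReal) - (c : EReal)) := by
  have e : ((1 - t : ℝ) : EReal) = (1 : EReal) - (ENNReal.ofReal t : EReal) := by
    rw [EReal.coe_ennreal_ofReal, max_eq_left ht]
    rfl
  rw [e]
  exact ⟨fun h => EReal.sub_le_sub le_rfl (by exact_mod_cast h),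
    fun h => EReal.sub_le_sub le_rfl (by exact_mod_cast h)⟩

lemma one_sub_inv_cot_le [CompleteSpace X] [Nontrivial X] {p : ℝ≥0∞} (hp1 : 1 ≤ p)
    (hp : p ≠ ⊤) :
    (1 : EReal) - (((cot X)⁻¹ : ℝ≥0∞) : EReal) ≤ ⨆ a ∈ dirichletHardy X p, sigmaAbs a := by
  set L := (1 : EReal) - (((cot X)⁻¹ : ℝ≥0∞) : EReal) with hL
  by_contra! hlt
  -- Since `cot X ≥ 2`, `L ≥ 1/2`; this leaves room for a positive `σ`, as the prime estimate
  -- requires.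
  have hL0 : (0 : EReal) < L := by
    have h1 : (cot X)⁻¹ ≤ ENNReal.ofReal (1 / 2) := by
      rw [one_div, ENNReal.ofReal_inv_of_pos two_pos, ENNReal.ofReal_ofNat]
      exact ENNReal.inv_le_inv.2 (two_le_cot X)
    refine lt_of_lt_of_le ?_ ((one_sub_le_of_ofReal_le (by norm_num)).2 h1)
    exact_mod_cast (by norm_num : (0 : ℝ) < 1 - 1 / 2)
  -- Three exponents `σ < τ < υ < L`: `σ` exceeds every abscissa, the gap to `τ` pays for replacing
  -- `p_k` by `k + 1`, and the gap to `υ` for passing from weak to strong summability. The outcome,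
  -- cotype `1/(1 - υ)`, contradicts `υ < L`.
  obtain ⟨σ, hσ1, hσL⟩ := EReal.lt_iff_exists_real_btwn.1 (max_lt hlt hL0)
  obtain ⟨τ, hτ, hτL⟩ := EReal.lt_iff_exists_real_btwn.1 hσL
  obtain ⟨υ, hυ, hυL⟩ := EReal.lt_iff_exists_real_btwn.1 hτL
  obtain ⟨hσ, hσ0⟩ := max_lt_iff.1 hσ1
  replace hσ0 : 0 < σ := by exact_mod_cast hσ0
  replace hτ : σ < τ := by exact_mod_cast hτ
  replace hυ : τ < υ := by exact_mod_cast hυ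
  have hυ1 : υ < 1 := by
    have h1 : L ≤ ((1 - 0 : ℝ) : EReal) := (one_sub_le_of_ofReal_le le_rfl).1 (by simp)
    have h2 := hυL.trans_le h1
    rw [sub_zero] at h2
    exact_mod_cast h2
  obtain ⟨C, hC0, hC⟩ := exists_sum_mul_norm_le (X := X) hp1 hp
    (z := fun k => ((prime k : ℕ) : ℝ) ^ (-σ))
    (fun k => by positivity) fun f hf => summable_prime_of_sigmaAbs_lt hσ hf
  obtain ⟨c, hc0, hc⟩ := exists_le_prime_rpow_neg hσ0 hτ
  have hcot : CotypeIneq X (1 - υ)⁻¹ := by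
    refine cotypeIneq_of_sum_rpow_le (τ := τ) (B := c⁻¹ * C) (by linarith) (by linarith)
      (by positivity) (fun N x => ?_) ?_
    · rw [mul_assoc, ← div_eq_inv_mul, le_div_iff₀ hc0]
      refine le_trans ?_ (hC N x)
      rw [Finset.sum_mul]
      refine Finset.sum_le_sum fun k _ => ?_
      calc _ = c * ((k : ℝ) + 1) ^ (-τ) * ‖x k‖ := by ring
        _ ≤ _ := by gcongr; exact hc k
    · rw [inv_mul_eq_div, one_lt_div (by linarith)]
      linarith
  have h1 : cot X ≤ ENNReal.ofReal (1 - υ)⁻¹ :=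
    iInf₂_le _ (hcot.hasCotype (inv_pos.2 (by linarith)))
  have h2 : ENNReal.ofReal (1 - υ) ≤ (cot X)⁻¹ := by
    rw [ENNReal.ofReal_inv_of_pos (by linarith)] at h1
    exact ENNReal.le_inv_iff_le_inv.1 h1
  have h3 := (one_sub_le_of_ofReal_le (by linarith)).1 h2
  rw [sub_sub_cancel] at h3
  exact absurd hυL (not_lt.2 h3)

/-- For `r > 1` the cotype result gives `cot X ≤ r'`, and `r ↦ 1 + (r - 1)⁻¹` is an order-reversing
involution; `r = 1` is trivial. -/
lemma monSize_le [CompleteSpace X] [Nontrivial X] {p : ℝ≥0∞} (hp1 : 1 ≤ p) (hp : p ≠ ⊤) :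
    monSize X p ≤ ENNReal.conjExponent (cot X) := by
  refine sSup_le fun r ⟨hr1, hr⟩ => ?_
  unfold ENNReal.conjExponent
  rcases hr1.eq_or_lt with rfl | hr1
  · exact le_self_add
  · have h1 : cot X ≤ ENNReal.conjExponent r :=
      (iInf₂_le _ (hr.hasCotype hp1 hp hr1)).trans ENNReal.ofReal_toReal_le
    unfold ENNReal.conjExponent at h1
    exact tsub_le_iff_left.1 (ENNReal.le_inv_iff_le_inv.1 (tsub_le_iff_left.2 h1))

end

end VHardy

end

theorem mainTheorem5 (X : Type*) [NormedAddCommGroup X] [NormedSpace ℂ X] [CompleteSpace X]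
    [Nontrivial X] (p : ℝ≥0∞) (hp1 : 1 ≤ p) (hp : p ≠ ⊤) :
    (∀ r : ℝ≥0∞, 1 < r → VHardy.LrSubsetMon X p r →
      VHardy.HasCotype X (ENNReal.conjExponent r).toReal) ∧
    VHardy.monSize X p ≤ ENNReal.conjExponent (VHardy.cot X) ∧
    (1 : EReal) - (((VHardy.cot X)⁻¹ : ℝ≥0∞) : EReal) ≤ VHardy.bohrStrip X p ∧
    (1 : EReal) - (((VHardy.cot X)⁻¹ : ℝ≥0∞) : EReal) ≤
      ⨆ a ∈ VHardy.dirichletHardy X p, VHardy.sigmaAbs a :=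
  ⟨fun _ hr h => h.hasCotype hp1 hp hr, VHardy.monSize_le hp1 hp,
    (VHardy.one_sub_inv_cot_le hp1 hp).trans (VHardy.iSup_sigmaAbs_le_bohrStrip p),
    VHardy.one_sub_inv_cot_le hp1 hp⟩
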